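/- Let $n,k$ be integers with $k\ge 4$ and $n>2k$, and write $[n]=\{1,\dots,n\}$, $[a,b]=\{a,a+1,\dots,b\}$, and $\binom{[n]}{k}$ for the collection of all $k$-element subsets of $[n]$. For a family $\mathcal F\subset\binom{[n]}{k}$ let $\gamma(\mathcal F)=|\mathcal F|-\Delta(\mathcal F)$ be its diversity, where $\Delta(\mathcal F)$ is the maximum over $i\in[n]$ of the number of sets in $\mathcal F$ that contain $i$. Put $I_i=[i+1,k+i]$ and $$\mathcal J_2=\{I_1,I_2\}\cup\Big\{F\in\binom{[n]}{k}: 1\in F,\ F\cap I_1\neq\emptyset,\ F\cap I_2\neq\emptyset\Big\}.$$ **Theorem.** Let $\mathcal F\subset\binom{[n]}{k}$ be an intersecting family (any two of its sets intersect) with $\gamma(\mathcal F)\ge 2$. Then $$|\mathcal F|\le\binom{n-1}{k-1}-\binom{n-k-1}{k-1}-\binom{n-k-2}{k-2}+2 .$$ Moreover, if $k\ge 5$, then equality holds if and only if $\mathcal F$ is isomorphic to $\mathcal J_2$, that is, some permutation of $[n]$ carries $\mathcal F$ to $\mathcal J_2$. -/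

import Mathlib

/-- The degree of `i` in `F`: the number of members of `F` that contain `i`. -/
def familyDegree {n : ℕ} (F : Finset (Finset (Fin n))) (i : Fin n) : ℕ :=
  (F.filter (fun A => i ∈ A)).card

/-- The maximal degree of an element of the ground set in `F`. -/
def familyMaxDegree {n : ℕ} (F : Finset (Finset (Fin n))) : ℕ :=
  Finset.univ.sup (familyDegree F)

/-- The diversity of `F`: its size minus its maximal degree (which never exceeds the size, so that
the subtraction does not truncate). -/
def diversity {n : ℕ} (F : Finset (Finset (Fin n))) : ℕ :=
  F.card - familyMaxDegree F

/-- The interval `[a, b]` of the ground set `[n] = {1, …, n}`; the element `x : Fin n` stands for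
the number `x + 1` of `[n]`. -/
def groundInterval (n a b : ℕ) : Finset (Fin n) :=
  Finset.univ.filter (fun x => a ≤ (x : ℕ) + 1 ∧ (x : ℕ) + 1 ≤ b)

/-- The `k`-set `I_i = [i + 1, k + i]`. -/
def intervalSet (n k i : ℕ) : Finset (Fin n) :=
  groundInterval n (i + 1) (k + i)

/-- The family `J_i`: the sets `I_1` and `I_i` together with all `k`-sets that contain the first
element of the ground set and meet both `I_1` and `I_i`. -/
def familyJ (n k i : ℕ) : Finset (Finset (Fin n)) :=
  {intervalSet n k 1, intervalSet n k i} ∪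
    (Finset.powersetCard k (Finset.univ : Finset (Fin n))).filter (fun A =>
      (∃ x ∈ A, (x : ℕ) + 1 = 1) ∧
        (A ∩ intervalSet n k 1).Nonempty ∧ (A ∩ intervalSet n k i).Nonempty)

/-- Two families on the same ground set are isomorphic if a permutation of the ground set carries
one to the other. -/
def FamilyIsomorphic {n : ℕ} (F G : Finset (Finset (Fin n))) : Prop :=
  ∃ σ : Equiv.Perm (Fin n), F.image (fun A => A.image σ) = G

/-!
Diversity at least `2` says that every element `c` is missed by at least two members of `F`. If
exactly two members `G₁`, `G₂` miss some `c`, all others contain `c` and meet both, and counting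
those sets gives the bound, with equality exactly when `G₁` and `G₂` differ in one element and all
such sets are present.

Suppose then that at least three members miss each element; the bound is now strict for `k ≥ 5`. A
compression `y ↦ x` may destroy this hypothesis, but only at `x` and only if at most two members
miss both `x` and `y`. In that case `F` splits according to `x` and `y` into four parts, and bounds
for cross-intersecting families finish the proof. Otherwise compressions continue until `F` is
shifted. For a shifted family, both the members through the greatest element `a`, with `a` removed,
and the members that avoid `a` are again intersecting and shifted, and the bound follows by Pascal's
rule and induction, starting from a ground set of size `2k`, where at most one of two complementary
sets belongs to `F`.
-/

open Finset

/-! ### Counting sets that meet given targets -/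

/-- The number of `(i + 1)`-subsets of an `(l + q + 1)`-set that miss one of two `l`-subsets
`T₁`, `T₂` differing in a single element `t ∈ T₁`: those that avoid `T₁`, and those that contain
`t` and avoid `T₂`. The number does not depend on `l`. -/
def missCount (q i : ℕ) : ℕ :=
  (q + 1).choose (i + 1) + q.choose i

theorem missCount_succ_succ (q i : ℕ) :
    missCount (q + 1) (i + 1) = missCount q i + missCount q (i + 1) := by
  simp only [missCount, Nat.choose_succ_succ' (q + 1) (i + 1), Nat.choose_succ_succ' q i]
  ring

theorem missCount_succ_right_add_choose (q i : ℕ) :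
    missCount q (i + 1) + q.choose i = (q + 2).choose (i + 2) := by
  rw [missCount, Nat.choose_succ_succ' (q + 1) (i + 1), Nat.choose_succ_succ' q i]
  ring

theorem missCount_self (q : ℕ) : missCount q q = 2 := by
  simp [missCount]

theorem two_le_choose {q i : ℕ} (hi : 0 < i) (hq : i < q) : 2 ≤ q.choose i :=
  calc 2 ≤ i + 1 := by lia
    _ = (i + 1).choose i := (Nat.choose_succ_self_right i).symm
    _ ≤ q.choose i := Nat.choose_le_choose i hq

theorem succ_le_choose {q i ε : ℕ} (hε : ε ≤ 1) (hεi : ε ≤ i) (hq : i + ε ≤ q) :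
    ε + 1 ≤ q.choose i := by
  interval_cases ε
  · exact Nat.choose_pos hq
  · exact two_le_choose hεi hq

theorem missCount_add_succ_le_choose {q i ε : ℕ} (hε : ε ≤ 1) (hεi : ε < i) (hq : i ≤ q) :
    missCount q i + ε + 1 ≤ (q + 2).choose (i + 1) := by
  obtain ⟨j, rfl⟩ := Nat.exists_eq_add_of_le' (Nat.one_le_of_lt hεi)
  rw [← missCount_succ_right_add_choose, add_assoc]
  gcongr
  exact succ_le_choose hε (by lia) (by lia)

section Counting

variable {α : Type*} [DecidableEq α] {S T T₁ T₂ Z : Finset α} {F H : Finset (Finset α)} {a t : α}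
  {i l m q : ℕ}

theorem memberSubfamily_subset_powersetCard_erase (hF : F ⊆ powersetCard (l + 1) S) :
    F.memberSubfamily a ⊆ powersetCard l (S.erase a) := by
  intro X hX
  obtain ⟨haX, ha⟩ := mem_memberSubfamily.1 hX
  obtain ⟨hsub, hcard⟩ := mem_powersetCard.1 (hF haX)
  rw [card_insert_of_notMem ha] at hcard
  exact mem_powersetCard.2
    ⟨subset_erase.2 ⟨(subset_insert a X).trans hsub, ha⟩, Nat.succ_injective hcard⟩

theorem nonMemberSubfamily_subset : F.nonMemberSubfamily a ⊆ F :=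
  filter_subset _ _

theorem nonMemberSubfamily_subset_powersetCard_erase (hF : F ⊆ powersetCard l S) :
    F.nonMemberSubfamily a ⊆ powersetCard l (S.erase a) := by
  intro X hX
  obtain ⟨hX, ha⟩ := mem_nonMemberSubfamily.1 hX
  obtain ⟨hsub, hcard⟩ := mem_powersetCard.1 (hF hX)
  exact mem_powersetCard.2 ⟨subset_erase.2 ⟨hsub, ha⟩, hcard⟩

theorem nonMemberSubfamily_comm (F : Finset (Finset α)) (a b : α) :
    (F.nonMemberSubfamily a).nonMemberSubfamily b =
      (F.nonMemberSubfamily b).nonMemberSubfamily a :=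
  filter_comm _ _ _

theorem nonMemberSubfamily_memberSubfamily_comm {a b : α} (hab : a ≠ b)
    (F : Finset (Finset α)) :
    (F.memberSubfamily a).nonMemberSubfamily b =
      (F.nonMemberSubfamily b).memberSubfamily a := by
  ext X
  simp only [mem_nonMemberSubfamily, mem_memberSubfamily, mem_insert, hab.symm, false_or]
  tauto

theorem card_memberSubfamily_of_nonMemberSubfamily_eq_empty (h : F.nonMemberSubfamily a = ∅) :
    #(F.memberSubfamily a) = #F := by
  rw [← card_memberSubfamily_add_card_nonMemberSubfamily a F, h, card_empty, add_zero]

theorem card_filter_meets_add_choose (hT : T ⊆ S) (hm : #S = #T + m) :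
    #{X ∈ powersetCard i S | (X ∩ T).Nonempty} + m.choose i = (#S).choose i := by
  have hmiss : {X ∈ powersetCard i S | ¬ (X ∩ T).Nonempty} = powersetCard i (S \ T) := by
    ext X
    simp only [mem_filter, mem_powersetCard, subset_sdiff, not_nonempty_iff_eq_empty,
      disjoint_iff_inter_eq_empty]
    tauto
  have hcard : #(S \ T) = m := by rw [card_sdiff_of_subset hT]; lia
  rw [← card_powersetCard, ← card_filter_add_card_filter_not (s := powersetCard i S)
    (fun X => (X ∩ T).Nonempty), hmiss, card_powersetCard, hcard]

theorem card_add_choose_le_of_meets (hH : H ⊆ powersetCard i S) (hT : T ⊆ S) (hm : #S = #T + m)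
    (hmeet : ∀ X ∈ H, (X ∩ T).Nonempty) : #H + m.choose i ≤ (#S).choose i := by
  rw [← card_filter_meets_add_choose hT hm]
  gcongr
  exact fun X hX => mem_filter.2 ⟨hH hX, hmeet X hX⟩

theorem erase_inter_nonempty_of_notMem (ht : t ∉ T) (h : (Z ∩ T).Nonempty) :
    (Z.erase t ∩ T).Nonempty := by
  rwa [erase_inter, erase_eq_of_notMem fun h' => ht (mem_inter.1 h').2]

-- Among the sets that contain `t`, only the target `T₂` matters; among the others, only the target
-- `T₁.erase t` does.
theorem card_add_missCount_le_of_mem_sdiff (hH : H ⊆ powersetCard (i + 1) S) (hT₁ : T₁ ⊆ S)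
    (hT₂ : T₂ ⊆ S) (hS₁ : #S = #T₁ + q + 1) (hS₂ : #S = #T₂ + q + 1) (ht : t ∈ T₁ \ T₂)
    (h₁ : ∀ X ∈ H, (X ∩ T₁).Nonempty) (h₂ : ∀ X ∈ H, t ∈ X → (X ∩ T₂).Nonempty) :
    #H + missCount q i ≤ (#S).choose (i + 1) := by
  obtain ⟨ht₁, ht₂⟩ := mem_sdiff.1 ht
  have hcardS := card_erase_add_one (hT₁ ht₁)
  have hcardT := card_erase_add_one ht₁
  have hmem : #(H.memberSubfamily t) + q.choose i ≤ (#(S.erase t)).choose i := by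
    refine card_add_choose_le_of_meets (memberSubfamily_subset_powersetCard_erase hH)
      (subset_erase.2 ⟨hT₂, ht₂⟩) (by lia) fun X hX => ?_
    obtain ⟨hXH, -⟩ := mem_memberSubfamily.1 hX
    have := h₂ _ hXH (mem_insert_self t X)
    rwa [insert_inter_of_notMem ht₂] at this
  have hnot : #(H.nonMemberSubfamily t) + (q + 1).choose (i + 1) ≤
      (#(S.erase t)).choose (i + 1) := by
    refine card_add_choose_le_of_meets (nonMemberSubfamily_subset_powersetCard_erase hH)
      (erase_subset_erase t hT₁) (by lia) fun X hX => ?_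
    obtain ⟨hXH, htX⟩ := mem_nonMemberSubfamily.1 hX
    rw [inter_comm]
    exact erase_inter_nonempty_of_notMem htX (inter_comm X T₁ ▸ h₁ X hXH)
  rw [← hcardS, Nat.choose_succ_succ', ← card_memberSubfamily_add_card_nonMemberSubfamily t H,
    missCount]
  lia

theorem exists_mem_sdiff_of_card_eq (hne : T₁ ≠ T₂) (hcard : #T₁ = #T₂) : ∃ t, t ∈ T₁ \ T₂ := by
  by_contra! h
  exact hne (eq_of_subset_of_card_le (sdiff_eq_empty_iff_subset.1 (eq_empty_of_forall_notMem h))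
    hcard.ge)

theorem card_add_missCount_le_of_meets (hH : H ⊆ powersetCard (i + 1) S)
    (hT₁ : T₁ ∈ powersetCard l S) (hT₂ : T₂ ∈ powersetCard l S) (hS : #S = l + q + 1)
    (hne : T₁ ≠ T₂) (h₁ : ∀ X ∈ H, (X ∩ T₁).Nonempty) (h₂ : ∀ X ∈ H, (X ∩ T₂).Nonempty) :
    #H + missCount q i ≤ (#S).choose (i + 1) := by
  rw [mem_powersetCard] at hT₁ hT₂
  obtain ⟨t, ht⟩ := exists_mem_sdiff_of_card_eq hne (hT₁.2.trans hT₂.2.symm)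
  exact card_add_missCount_le_of_mem_sdiff hH hT₁.1 hT₂.1 (by lia) (by lia) ht h₁
    fun X hX _ => h₂ X hX

theorem card_add_missCount_lt_of_meets {T₃ : Finset α} (hH : H ⊆ powersetCard (i + 1) S)
    (hT₁ : T₁ ∈ powersetCard l S) (hT₂ : T₂ ∈ powersetCard l S) (hT₃ : T₃ ∈ powersetCard l S)
    (hS : #S = l + q + 1) (hi : 1 ≤ i) (hiq : i ≤ q) (h₁₂ : T₁ ≠ T₂) (h₁₃ : T₁ ≠ T₃)
    (h₂₃ : T₂ ≠ T₃) (h₁ : ∀ X ∈ H, (X ∩ T₁).Nonempty) (h₂ : ∀ X ∈ H, (X ∩ T₂).Nonempty)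
    (h₃ : ∀ X ∈ H, (X ∩ T₃).Nonempty) :
    #H + missCount q i < (#S).choose (i + 1) := by
  have hcard {T : Finset α} (hT : T ∈ powersetCard l S) : #T = l := (mem_powersetCard.1 hT).2
  obtain ⟨x, hx⟩ := exists_mem_sdiff_of_card_eq h₁₃ ((hcard hT₁).trans (hcard hT₃).symm)
  obtain ⟨y, hy⟩ := exists_mem_sdiff_of_card_eq h₂₃ ((hcard hT₂).trans (hcard hT₃).symm)
  have hxy : {x, y} ⊆ S \ T₃ := by
    rw [insert_subset_iff, singleton_subset_iff]
    exact ⟨sdiff_subset_sdiff (mem_powersetCard.1 hT₁).1 le_rfl hx,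
      sdiff_subset_sdiff (mem_powersetCard.1 hT₂).1 le_rfl hy⟩
  have hroom : i + 1 ≤ #(S \ T₃) := by
    have := le_card_sdiff T₃ S
    have := hcard hT₃
    lia
  -- `Z` meets `T₁` and `T₂` but not `T₃`, so it can be added to `H`.
  obtain ⟨Z, hxyZ, hZ, hZcard⟩ :=
    exists_subsuperset_card_eq hxy (card_le_two.trans (by lia)) hroom
  have hZH : Z ∉ H := fun h =>
    (h₃ Z h).ne_empty (disjoint_iff_inter_eq_empty.1 (subset_sdiff.1 hZ).2)
  have hZ₁ : (Z ∩ T₁).Nonempty := ⟨x, mem_inter.2 ⟨hxyZ (by simp), (mem_sdiff.1 hx).1⟩⟩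
  have hZ₂ : (Z ∩ T₂).Nonempty := ⟨y, mem_inter.2 ⟨hxyZ (by simp), (mem_sdiff.1 hy).1⟩⟩
  have hins := card_add_missCount_le_of_meets
    (insert_subset (mem_powersetCard.2 ⟨(subset_sdiff.1 hZ).1, hZcard⟩) hH) hT₁ hT₂ hS h₁₂
    (forall_mem_insert .. |>.2 ⟨hZ₁, h₁⟩) (forall_mem_insert .. |>.2 ⟨hZ₂, h₂⟩)
  rw [card_insert_of_notMem hZH] at hins
  lia

end Counting

section CrossIntersecting

variable {α : Type*} [DecidableEq α] {S : Finset α} {A B A' B' F : Finset (Finset α)} {a : α}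
  {i l m q : ℕ}

/-- Two families are cross-intersecting if every member of the first meets every member of the
second. A family is intersecting if it is cross-intersecting with itself; its members are then
nonempty. -/
def CrossIntersecting (A B : Finset (Finset α)) : Prop :=
  ∀ X ∈ A, ∀ Y ∈ B, (X ∩ Y).Nonempty

namespace CrossIntersecting

theorem symm (h : CrossIntersecting A B) : CrossIntersecting B A :=
  fun X hX Y hY => inter_comm Y X ▸ h Y hY X hX

theorem mono (h : CrossIntersecting A B) (hA : A' ⊆ A) (hB : B' ⊆ B) : CrossIntersecting A' B' :=
  fun X hX Y hY => h X (hA hX) Y (hB hY)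

theorem nonMemberSubfamily (h : CrossIntersecting A B) :
    CrossIntersecting (A.nonMemberSubfamily a) (B.nonMemberSubfamily a) :=
  h.mono nonMemberSubfamily_subset nonMemberSubfamily_subset

theorem memberSubfamily_nonMemberSubfamily (h : CrossIntersecting A B) :
    CrossIntersecting (A.memberSubfamily a) (B.nonMemberSubfamily a) := by
  intro X hX Y hY
  obtain ⟨hXA, -⟩ := mem_memberSubfamily.1 hX
  obtain ⟨hYB, haY⟩ := mem_nonMemberSubfamily.1 hY
  have := h _ hXA _ hYB
  rwa [insert_inter_of_notMem haY] at this

theorem pos (h : CrossIntersecting A B) (hA : A ⊆ powersetCard l S) (hAn : A.Nonempty)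
    (hBn : B.Nonempty) : 0 < l := by
  obtain ⟨X, hX⟩ := hAn
  obtain ⟨Y, hY⟩ := hBn
  rw [← (mem_powersetCard.1 (hA hX)).2, card_pos]
  exact (h X hX Y hY).mono inter_subset_left

theorem card_add_choose_le (h : CrossIntersecting A B) (hA : A ⊆ powersetCard i S)
    (hB : B ⊆ powersetCard l S) (hS : #S = l + m) (hBn : B.Nonempty) :
    #A + m.choose i ≤ (#S).choose i := by
  obtain ⟨T, hT⟩ := hBn
  obtain ⟨hTS, hTcard⟩ := mem_powersetCard.1 (hB hT)
  exact card_add_choose_le_of_meets hA hTS (by lia) fun X hX => h X hX T hT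

theorem card_add_missCount_le (h : CrossIntersecting A B) (hA : A ⊆ powersetCard (i + 1) S)
    (hB : B ⊆ powersetCard l S) (hS : #S = l + q + 1) (hB₂ : 2 ≤ #B) :
    #A + missCount q i ≤ (#S).choose (i + 1) := by
  obtain ⟨T₁, hT₁, T₂, hT₂, hne⟩ := one_lt_card.1 hB₂
  exact card_add_missCount_le_of_meets hA (hB hT₁) (hB hT₂) hS hne
    (fun X hX => h X hX T₁ hT₁) (fun X hX => h X hX T₂ hT₂)

theorem card_add_missCount_lt (h : CrossIntersecting A B) (hA : A ⊆ powersetCard (i + 1) S)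
    (hB : B ⊆ powersetCard l S) (hS : #S = l + q + 1) (hi : 1 ≤ i) (hiq : i ≤ q)
    (hB₃ : 3 ≤ #B) : #A + missCount q i < (#S).choose (i + 1) := by
  obtain ⟨T₁, T₂, T₃, hT₁, hT₂, hT₃, h₁₂, h₁₃, h₂₃⟩ := two_lt_card_iff.1 hB₃
  exact card_add_missCount_lt_of_meets hA (hB hT₁) (hB hT₂) (hB hT₃) hS hi hiq h₁₂ h₁₃ h₂₃
    (fun X hX => h X hX T₁ hT₁) (fun X hX => h X hX T₂ hT₂) (fun X hX => h X hX T₃ hT₃)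

-- Here and below `ε` merges two statements: the bound (`ε = 0`) and its strict form (`ε = 1`).
theorem card_add_missCount_add_le {ε : ℕ} (h : CrossIntersecting A B)
    (hA : A ⊆ powersetCard (i + 1) S) (hB : B ⊆ powersetCard l S) (hS : #S = l + q + 1)
    (hε : ε ≤ 1) (hi : 1 ≤ i) (hiq : i ≤ q) (hB₂ : 2 + ε ≤ #B) :
    #A + missCount q i + ε ≤ (#S).choose (i + 1) := by
  interval_cases ε
  · exact h.card_add_missCount_le hA hB hS hB₂
  · exact h.card_add_missCount_lt hA hB hS hi hiq hB₂

-- At most one member of each complementary pair is used: `X` in `A` or `S \ X` in `B`.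
theorem card_add_card_le_choose (h : CrossIntersecting A B) (hA : A ⊆ powersetCard l S)
    (hB : B ⊆ powersetCard l S) (hS : #S = 2 * l) : #A + #B ≤ (#S).choose l := by
  have hinj : Set.InjOn (S \ ·) (B : Set (Finset α)) := by
    intro X hX Y hY hXY
    rw [← Finset.sdiff_sdiff_eq_self (mem_powersetCard.1 (hB hX)).1,
      ← Finset.sdiff_sdiff_eq_self (mem_powersetCard.1 (hB hY)).1]
    exact congrArg (S \ ·) hXY
  have hdisj : Disjoint A (B.image (S \ ·)) := by
    rw [disjoint_left]
    intro X hX hX'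
    obtain ⟨Y, hY, rfl⟩ := mem_image.1 hX'
    exact (h _ hX Y hY).ne_empty (sdiff_inter_self Y S)
  have hsub : A ∪ B.image (S \ ·) ⊆ powersetCard l S := by
    refine union_subset hA (image_subset_iff.2 fun Y hY => ?_)
    obtain ⟨hYS, hYcard⟩ := mem_powersetCard.1 (hB hY)
    rw [mem_powersetCard, card_sdiff_of_subset hYS]
    exact ⟨sdiff_subset, by lia⟩
  rw [← card_image_of_injOn hinj, ← card_union_of_disjoint hdisj, ← card_powersetCard]
  exact card_le_card hsub

theorem card_self_le_choose (h : CrossIntersecting F F) (hF : F ⊆ powersetCard (m + 1) S)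
    (hS : #S = 2 * (m + 1)) : #F ≤ (2 * m + 1).choose m := by
  have htwo := h.card_add_card_le_choose hF hF hS
  rw [hS, show 2 * (m + 1) = 2 * m + 1 + 1 by ring, Nat.choose_succ_succ',
    Nat.choose_symm_half] at htwo
  lia

end CrossIntersecting

end CrossIntersecting

/-! ### Shifted families -/

section Shifted

variable {α : Type*} [LinearOrder α] {S : Finset α} {A B F : Finset (Finset α)} {a c : α}
  {i l m q ε : ℕ}

/-- A family of `l`-subsets of `S` is shifted if replacing an element of a member by a smaller
element of `S` yields another member. -/
structure IsShifted (S : Finset α) (l : ℕ) (F : Finset (Finset α)) : Prop where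
  subset_powersetCard : F ⊆ powersetCard l S
  insert_erase_mem : ∀ X ∈ F, ∀ y ∈ X, ∀ x ∈ S, x < y → x ∉ X → insert x (X.erase y) ∈ F

theorem isLeast_erase_of_isGreatest (ha : IsGreatest (S : Set α) a) (hc : IsLeast (S : Set α) c)
    (hS : 1 < #S) : IsLeast (S.erase a : Set α) c := by
  refine ⟨mem_coe.2 (mem_erase.2 ⟨?_, hc.1⟩), fun x hx => hc.2 (mem_of_mem_erase hx)⟩
  rintro rfl
  obtain ⟨x, hx, y, hy, hxy⟩ := one_lt_card.1 hS
  exact hxy (((ha.2 hx).antisymm (hc.2 hx)).trans ((ha.2 hy).antisymm (hc.2 hy)).symm)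

namespace IsShifted

theorem nonMemberSubfamily (hF : IsShifted S l F) (a : α) :
    IsShifted (S.erase a) l (F.nonMemberSubfamily a) where
  subset_powersetCard := nonMemberSubfamily_subset_powersetCard_erase hF.subset_powersetCard
  insert_erase_mem X hX y hy x hx hxy hxX := by
    obtain ⟨hXF, haX⟩ := mem_nonMemberSubfamily.1 hX
    obtain ⟨hxa, hxS⟩ := mem_erase.1 hx
    refine mem_nonMemberSubfamily.2 ⟨hF.insert_erase_mem X hXF y hy x hxS hxy hxX, ?_⟩
    simp [hxa.symm, haX]

theorem memberSubfamily (hF : IsShifted S (l + 1) F) (a : α) :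
    IsShifted (S.erase a) l (F.memberSubfamily a) where
  subset_powersetCard := memberSubfamily_subset_powersetCard_erase hF.subset_powersetCard
  insert_erase_mem X hX y hy x hx hxy hxX := by
    obtain ⟨hXF, haX⟩ := mem_memberSubfamily.1 hX
    obtain ⟨hxa, hxS⟩ := mem_erase.1 hx
    have hay : a ≠ y := fun h => haX (h ▸ hy)
    have := hF.insert_erase_mem _ hXF y (mem_insert_of_mem hy) x hxS hxy (by simp [hxa, hxX])
    rw [erase_insert_of_ne hay, insert_comm] at this
    exact mem_memberSubfamily.2 ⟨this, by simp [hxa.symm, haX]⟩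

theorem insert_mem_nonMemberSubfamily (hF : IsShifted S l F) (ha : IsGreatest (S : Set α) a)
    {X : Finset α} (hX : X ∈ F.memberSubfamily a) {x : α} (hx : x ∈ S.erase a) (hxX : x ∉ X) :
    insert x X ∈ F.nonMemberSubfamily a := by
  obtain ⟨hXF, haX⟩ := mem_memberSubfamily.1 hX
  obtain ⟨hxa, hxS⟩ := mem_erase.1 hx
  have := hF.insert_erase_mem _ hXF a (mem_insert_self a X) x hxS
    (lt_of_le_of_ne (ha.2 hxS) hxa) (by simp [hxa, hxX])
  rw [erase_insert haX] at this
  exact mem_nonMemberSubfamily.2 ⟨this, by simp [hxa.symm, haX]⟩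

theorem le_card_nonMemberSubfamily (hF : IsShifted S (l + 1) F) (ha : IsGreatest (S : Set α) a)
    (hm : m ≤ #F) (hml : m + l < #S) : m ≤ #(F.nonMemberSubfamily a) := by
  rcases (F.memberSubfamily a).eq_empty_or_nonempty with hempty | ⟨X, hX⟩
  · rwa [← card_memberSubfamily_add_card_nonMemberSubfamily a F, hempty, card_empty,
      zero_add] at hm
  have hXcard := (mem_powersetCard.1 ((hF.memberSubfamily a).subset_powersetCard hX)).2
  have himage : ((S.erase a) \ X).image (insert · X) ⊆ F.nonMemberSubfamily a :=
    image_subset_iff.2 fun x hx => by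
      obtain ⟨hxS, hxX⟩ := mem_sdiff.1 hx
      exact hF.insert_mem_nonMemberSubfamily ha hX hxS hxX
  have hinj : Set.InjOn (insert · X) ((S.erase a) \ X : Finset α) := fun x hx y _ hxy =>
    (insert_inj (mem_sdiff.1 hx).2).1 hxy
  have hcard := card_le_card himage
  rw [card_image_of_injOn hinj] at hcard
  have := le_card_sdiff X (S.erase a)
  have := card_erase_add_one ha.1
  lia

theorem le_card_nonMemberSubfamily_nonMemberSubfamily (hF : IsShifted S (l + 1) F)
    (ha : IsGreatest (S : Set α) a) (hac : a ≠ c) (hm : m ≤ #(F.nonMemberSubfamily c))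
    (hml : m + l + 1 < #S) : m ≤ #((F.nonMemberSubfamily a).nonMemberSubfamily c) := by
  rw [nonMemberSubfamily_comm]
  refine (hF.nonMemberSubfamily c).le_card_nonMemberSubfamily
    ⟨mem_erase.2 ⟨hac, ha.1⟩, fun x hx => ha.2 (mem_of_mem_erase hx)⟩ hm ?_
  have := pred_card_le_card_erase (s := S) (a := c)
  lia

end IsShifted

-- Sets `X`, `Y` through `a` cannot meet in `a` alone: the sizes leave room for some `x` outside
-- both, and shifting `a` to `x` in `X` would separate them.
theorem CrossIntersecting.memberSubfamily (h : CrossIntersecting A B)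
    (hA : IsShifted S (l + 1) A) (hB : IsShifted S (l + 1) B) (ha : IsGreatest (S : Set α) a)
    (hl : 2 * l + 1 < #S) :
    CrossIntersecting (A.memberSubfamily a) (B.memberSubfamily a) := by
  intro X hX Y hY
  have hXcard := (mem_powersetCard.1 ((hA.memberSubfamily a).subset_powersetCard hX)).2
  have hYcard := (mem_powersetCard.1 ((hB.memberSubfamily a).subset_powersetCard hY)).2
  have hroom : #(X ∪ Y) < #(S.erase a) := by
    have := card_union_le X Y
    have := card_erase_add_one ha.1
    lia
  obtain ⟨x, hx, hxXY⟩ := exists_mem_notMem_of_card_lt_card hroom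
  rw [notMem_union] at hxXY
  obtain ⟨hxA, haxX⟩ :=
    mem_nonMemberSubfamily.1 (hA.insert_mem_nonMemberSubfamily ha hX hx hxXY.1)
  have hmeet := h _ hxA _ (mem_memberSubfamily.1 hY).1
  rwa [inter_insert_of_notMem haxX, insert_inter_of_notMem hxXY.2] at hmeet

theorem CrossIntersecting.card_add_card_add_choose_le_of_isShifted (h : CrossIntersecting A B)
    (hA : IsShifted S l A) (hB : IsShifted S l B) (hS : #S = l + m) (hlm : l ≤ m)
    (hAn : A.Nonempty) (hBn : B.Nonempty) :
    #A + #B + m.choose l ≤ (#S).choose l + 1 := by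
  induction S using Finset.strongInduction generalizing l m A B with
  | H S ih =>
  have hl := h.pos hA.subset_powersetCard hAn hBn
  rcases hlm.eq_or_lt with rfl | hlm
  · have := h.card_add_card_le_choose hA.subset_powersetCard hB.subset_powersetCard (by lia)
    rw [Nat.choose_self]
    lia
  obtain ⟨l, rfl⟩ := Nat.exists_eq_add_of_le' hl
  obtain ⟨m, rfl⟩ := Nat.exists_eq_add_of_le' (Nat.one_le_of_lt hlm)
  have ha := S.isGreatest_max' (card_pos.1 (by lia))
  set a := S.max' _
  have hcard := card_erase_add_one ha.1
  have hA₀ := card_pos.1 (hA.le_card_nonMemberSubfamily ha (card_pos.2 hAn) (by lia))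
  have hB₀ := card_pos.1 (hB.le_card_nonMemberSubfamily ha (card_pos.2 hBn) (by lia))
  have hnonmember := ih _ (erase_ssubset ha.1) h.nonMemberSubfamily (hA.nonMemberSubfamily a)
    (hB.nonMemberSubfamily a) (m := m) (by lia) (by lia) hA₀ hB₀
  have hmember : #(A.memberSubfamily a) + #(B.memberSubfamily a) + m.choose l ≤
      (#(S.erase a)).choose l := by
    rcases (A.memberSubfamily a).eq_empty_or_nonempty with hempty | hA₁
    · rw [hempty, card_empty, zero_add]
      exact h.symm.memberSubfamily_nonMemberSubfamily.card_add_choose_le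
        (hB.memberSubfamily a).subset_powersetCard (hA.nonMemberSubfamily a).subset_powersetCard
        (by lia) hA₀
    rcases (B.memberSubfamily a).eq_empty_or_nonempty with hempty | hB₁
    · rw [hempty, card_empty, add_zero]
      exact h.memberSubfamily_nonMemberSubfamily.card_add_choose_le
        (hA.memberSubfamily a).subset_powersetCard (hB.nonMemberSubfamily a).subset_powersetCard
        (by lia) hB₀
    have h₁ := h.memberSubfamily hA hB ha (by lia)
    obtain ⟨j, rfl⟩ :=
      Nat.exists_eq_add_of_le' (h₁.pos (hA.memberSubfamily a).subset_powersetCard hA₁ hB₁)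
    have := ih _ (erase_ssubset ha.1) h₁ (hA.memberSubfamily a) (hB.memberSubfamily a)
      (m := m + 1) (by lia) (by lia) hA₁ hB₁
    have := Nat.choose_pos (show j ≤ m by lia)
    rw [Nat.choose_succ_succ' m] at *
    lia
  rw [← card_memberSubfamily_add_card_nonMemberSubfamily a A,
    ← card_memberSubfamily_add_card_nonMemberSubfamily a B, ← hcard, Nat.choose_succ_succ' m,
    Nat.choose_succ_succ' (#(S.erase a))]
  lia

theorem CrossIntersecting.card_memberSubfamily_add_missCount_le (h : CrossIntersecting A B)
    (hA : IsShifted S (i + 2) A) (hB : IsShifted S (i + 2) B) (ha : IsGreatest (S : Set α) a)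
    (hS : #S = i + q + 4) (hiq : i ≤ q) (hε : ε ≤ 1) (hεi : ε < i)
    (hA₀ : 2 + ε ≤ #(A.nonMemberSubfamily a)) (hB₀ : 2 + ε ≤ #(B.nonMemberSubfamily a)) :
    #(A.memberSubfamily a) + #(B.memberSubfamily a) + missCount q i + ε ≤
      (#(S.erase a)).choose (i + 1) := by
  have hcard := card_erase_add_one ha.1
  have hA₁ := hA.memberSubfamily a
  have hB₁ := hB.memberSubfamily a
  rcases (A.memberSubfamily a).eq_empty_or_nonempty with hempty | hA₁n
  · rw [hempty, card_empty, zero_add]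
    exact h.symm.memberSubfamily_nonMemberSubfamily.card_add_missCount_add_le
      hB₁.subset_powersetCard (hA.nonMemberSubfamily a).subset_powersetCard (by lia) hε (by lia)
      hiq hA₀
  rcases (B.memberSubfamily a).eq_empty_or_nonempty with hempty | hB₁n
  · rw [hempty, card_empty, add_zero]
    exact h.memberSubfamily_nonMemberSubfamily.card_add_missCount_add_le
      hA₁.subset_powersetCard (hB.nonMemberSubfamily a).subset_powersetCard (by lia) hε (by lia)
      hiq hB₀
  have := (h.memberSubfamily hA hB ha (by lia)).card_add_card_add_choose_le_of_isShifted hA₁ hB₁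
    (m := q + 2) (by lia) (by lia) hA₁n hB₁n
  have := missCount_add_succ_le_choose hε hεi hiq
  lia

-- In the inductive step only the members through `a` have to supply the strictness.
theorem CrossIntersecting.card_add_card_add_missCount_le_of_isShifted
    (h : CrossIntersecting A B) (hA : IsShifted S (i + 2) A) (hB : IsShifted S (i + 2) B)
    (hS : #S = i + q + 3) (hiq : i + 1 + ε ≤ q) (hε : ε ≤ 1) (hεi : ε < i)
    (hA₂ : 2 + ε ≤ #A) (hB₂ : 2 + ε ≤ #B) :
    #A + #B + missCount q (i + 1) + ε ≤ (#S).choose (i + 2) + 2 := by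
  induction S using Finset.strongInduction generalizing q ε A B with
  | H S ih =>
  rcases (show i + 1 ≤ q by lia).eq_or_lt with rfl | hlt
  · have := h.card_add_card_le_choose hA.subset_powersetCard hB.subset_powersetCard (by lia)
    rw [missCount_self]
    lia
  obtain ⟨q, rfl⟩ := Nat.exists_eq_add_of_le' (Nat.one_le_of_lt hlt)
  have ha := S.isGreatest_max' (card_pos.1 (by lia))
  set a := S.max' _
  have hcard := card_erase_add_one ha.1
  have hA₀ := hA.le_card_nonMemberSubfamily ha hA₂ (by lia)
  have hB₀ := hB.le_card_nonMemberSubfamily ha hB₂ (by lia)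
  have hnonmember := ih _ (erase_ssubset ha.1) h.nonMemberSubfamily (hA.nonMemberSubfamily a)
    (hB.nonMemberSubfamily a) (q := q) (ε := 0) (by lia) (by lia) (by lia) (by lia) (by lia)
  have hmember := h.card_memberSubfamily_add_missCount_le hA hB ha (q := q) (by lia) (by lia)
    hε hεi hA₀ hB₀
  rw [← card_memberSubfamily_add_card_nonMemberSubfamily a A,
    ← card_memberSubfamily_add_card_nonMemberSubfamily a B, ← hcard, missCount_succ_succ,
    Nat.choose_succ_succ']
  lia

namespace IsShifted

theorem pos_of_nonMemberSubfamily_nonempty (hF : IsShifted S (l + 1) F)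
    (h : CrossIntersecting F F) (hc : IsLeast (S : Set α) c)
    (hn : (F.nonMemberSubfamily c).Nonempty) : 0 < l := by
  rw [Nat.pos_iff_ne_zero]
  rintro rfl
  obtain ⟨X, hX⟩ := hn
  obtain ⟨hXF, hcX⟩ := mem_nonMemberSubfamily.1 hX
  obtain ⟨hXS, hXcard⟩ := mem_powersetCard.1 (hF.subset_powersetCard hXF)
  obtain ⟨x, rfl⟩ := card_eq_one.1 hXcard
  have hcx : c ≠ x := fun hcx => hcX (mem_singleton.2 hcx)
  have hshift := hF.insert_erase_mem _ hXF x (mem_singleton_self x) c hc.1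
    (lt_of_le_of_ne (hc.2 (singleton_subset_iff.1 hXS)) hcx) hcX
  have hmeet := h _ hshift _ hXF
  rw [erase_singleton, insert_empty, singleton_inter_of_notMem hcX] at hmeet
  exact not_nonempty_empty hmeet

theorem hilton_milner (hF : IsShifted S (l + 1) F) (h : CrossIntersecting F F)
    (hc : IsLeast (S : Set α) c) (hS : #S = l + m + 2) (hlm : l ≤ m)
    (hn : (F.nonMemberSubfamily c).Nonempty) :
    #F + m.choose l ≤ (l + m + 1).choose l + 1 := by
  induction S using Finset.strongInduction generalizing l m F with
  | H S ih =>
  rcases hlm.eq_or_lt with rfl | hlm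
  · have := h.card_self_le_choose hF.subset_powersetCard (by lia)
    rw [Nat.choose_self, ← two_mul]
    lia
  obtain ⟨l, rfl⟩ := Nat.exists_eq_add_of_le' (hF.pos_of_nonMemberSubfamily_nonempty h hc hn)
  obtain ⟨m, rfl⟩ := Nat.exists_eq_add_of_le' (Nat.one_le_of_lt hlm)
  have ha := S.isGreatest_max' (card_pos.1 (by lia))
  set a := S.max' _
  have hcard := card_erase_add_one ha.1
  have hc' := isLeast_erase_of_isGreatest ha hc (by lia)
  have hcard' := card_erase_add_one hc'.1
  have hF₀ := card_pos.1 (hF.le_card_nonMemberSubfamily_nonMemberSubfamily ha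
    (ne_of_mem_erase hc'.1).symm (card_pos.2 hn) (by lia))
  have hnonmember := ih _ (erase_ssubset ha.1) (hF.nonMemberSubfamily a) h.nonMemberSubfamily
    (m := m) hc' (by lia) (by lia) hF₀
  have hmember : #(F.memberSubfamily a) + m.choose l ≤ (l + m + 2).choose l := by
    have hF₁ := hF.memberSubfamily a
    rcases ((F.memberSubfamily a).nonMemberSubfamily c).eq_empty_or_nonempty with hempty | hF₁n
    · rw [← card_memberSubfamily_of_nonMemberSubfamily_eq_empty hempty,
        show l + m + 2 = #((S.erase a).erase c) by lia]
      exact h.memberSubfamily_nonMemberSubfamily.memberSubfamily_nonMemberSubfamily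
        |>.card_add_choose_le (memberSubfamily_subset_powersetCard_erase hF₁.subset_powersetCard)
          ((hF.nonMemberSubfamily a).nonMemberSubfamily c).subset_powersetCard (by lia) hF₀
    have h₁ := h.memberSubfamily hF hF ha (by lia)
    obtain ⟨j, rfl⟩ :=
      Nat.exists_eq_add_of_le' (hF₁.pos_of_nonMemberSubfamily_nonempty h₁ hc' hF₁n)
    have := ih _ (erase_ssubset ha.1) hF₁ h₁ (m := m + 1) hc' (by lia) (by lia) hF₁n
    have := Nat.choose_pos (show j ≤ m by lia)
    rw [Nat.choose_succ_succ' m, show j + 1 + (m + 1) + 1 = j + 1 + m + 2 by ring] at *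
    lia
  have hpascal := Nat.choose_succ_succ' (l + m + 2) l
  rw [← card_memberSubfamily_add_card_nonMemberSubfamily a F, Nat.choose_succ_succ' m,
    show l + 1 + (m + 1) + 1 = l + m + 2 + 1 by ring]
  rw [show l + 1 + m + 1 = l + m + 2 by ring] at hnonmember
  lia

theorem card_memberSubfamily_add_missCount_le (hF : IsShifted S (i + 3) F)
    (h : CrossIntersecting F F) (ha : IsGreatest (S : Set α) a) (hc : IsLeast (S : Set α) c)
    (hS : #S = i + q + 6) (hiq : i ≤ q) (hε : ε ≤ 1) (hεi : ε < i)
    (h₃ : 3 ≤ #((F.nonMemberSubfamily a).nonMemberSubfamily c)) :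
    #(F.memberSubfamily a) + missCount q i + ε ≤ (i + q + 4).choose (i + 1) := by
  have hF₁ := hF.memberSubfamily a
  have hc' := isLeast_erase_of_isGreatest ha hc (by lia)
  have hcard := card_erase_add_one ha.1
  have hcard' := card_erase_add_one hc'.1
  rcases ((F.memberSubfamily a).nonMemberSubfamily c).eq_empty_or_nonempty with hempty | hF₁n
  · rw [← card_memberSubfamily_of_nonMemberSubfamily_eq_empty hempty,
      show i + q + 4 = #((S.erase a).erase c) by lia]
    exact h.memberSubfamily_nonMemberSubfamily.memberSubfamily_nonMemberSubfamily
      |>.card_add_missCount_add_le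
        (memberSubfamily_subset_powersetCard_erase hF₁.subset_powersetCard)
        ((hF.nonMemberSubfamily a).nonMemberSubfamily c).subset_powersetCard (by lia) hε
        (by lia) hiq (by lia)
  have := hF₁.hilton_milner (h.memberSubfamily hF hF ha (by lia)) hc' (m := q + 2) (by lia)
    (by lia) hF₁n
  have := missCount_add_succ_le_choose hε hεi hiq
  rw [show i + 1 + (q + 2) + 1 = i + q + 4 by ring] at *
  lia

theorem card_add_missCount_le (hF : IsShifted S (i + 3) F) (h : CrossIntersecting F F)
    (hc : IsLeast (S : Set α) c) (hS : #S = i + q + 5) (hiq : i + 1 + ε ≤ q)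
    (hε : ε ≤ 1) (hεi : ε < i) (h₃ : 3 ≤ #(F.nonMemberSubfamily c)) :
    #F + missCount q (i + 1) + ε ≤ (i + q + 4).choose (i + 2) + 2 := by
  induction S using Finset.strongInduction generalizing q ε F with
  | H S ih =>
  rcases (show i + 1 ≤ q by lia).eq_or_lt with rfl | hlt
  · have := h.card_self_le_choose hF.subset_powersetCard (by lia)
    rw [missCount_self, show i + (i + 1) + 4 = 2 * (i + 2) + 1 by ring]
    lia
  obtain ⟨q, rfl⟩ := Nat.exists_eq_add_of_le' (Nat.one_le_of_lt hlt)
  have ha := S.isGreatest_max' (card_pos.1 (by lia))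
  set a := S.max' _
  have hcard := card_erase_add_one ha.1
  have hc' := isLeast_erase_of_isGreatest ha hc (by lia)
  have hF₀ := hF.le_card_nonMemberSubfamily_nonMemberSubfamily ha (ne_of_mem_erase hc'.1).symm
    h₃ (by lia)
  have hnonmember := ih _ (erase_ssubset ha.1) (hF.nonMemberSubfamily a) h.nonMemberSubfamily hc'
    (q := q) (ε := 0) (by lia) (by lia) (by lia) (by lia) hF₀
  have hmember := hF.card_memberSubfamily_add_missCount_le h ha hc (q := q) (by lia) (by lia)
    hε hεi hF₀
  rw [← card_memberSubfamily_add_card_nonMemberSubfamily a F, missCount_succ_succ,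
    ← add_assoc i q 1, Nat.add_right_comm _ 1 4, Nat.choose_succ_succ']
  lia

end IsShifted

end Shifted

/-! ### Compression -/

section Compression

open UV

section DecidableEq

variable {α : Type*} [DecidableEq α] {S X : Finset α} {A B F : Finset (Finset α)} {c x y : α}
  {l : ℕ}

theorem compress_singleton_of_notMem_of_mem (hx : x ∉ X) (hy : y ∈ X) :
    compress {x} {y} X = insert x (X.erase y) := by
  have hxy : x ∉ ({y} : Finset α) := fun h => hx (mem_singleton.1 h ▸ hy)
  rw [compress_of_disjoint_of_le (disjoint_singleton_left.2 hx) (singleton_subset_iff.2 hy),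
    sup_eq_union, union_comm, ← insert_eq, insert_sdiff_of_notMem X hxy, sdiff_singleton_eq_erase]

theorem compress_singleton_of_not (h : ¬ (x ∉ X ∧ y ∈ X)) : compress {x} {y} X = X :=
  if_neg fun h' => h ⟨disjoint_singleton_left.1 h'.1, singleton_subset_iff.1 h'.2⟩

theorem mem_compression_singleton : X ∈ compression {x} {y} F ↔
    (X ∈ F ∧ (x ∉ X → y ∈ X → insert x (X.erase y) ∈ F)) ∨
      (X ∉ F ∧ ∃ Y ∈ F, x ∉ Y ∧ y ∈ Y ∧ insert x (Y.erase y) = X) := by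
  rw [mem_compression]
  refine or_congr (and_congr_right fun hX => ?_) (and_congr_right fun hX => ?_)
  · by_cases h : x ∉ X ∧ y ∈ X
    · simp [compress_singleton_of_notMem_of_mem h.1 h.2, h.1, h.2]
    · rw [compress_singleton_of_not h]
      tauto
  · refine exists_congr fun Y => and_congr_right fun hY => ?_
    by_cases h : x ∉ Y ∧ y ∈ Y
    · simp [compress_singleton_of_notMem_of_mem h.1 h.2, h.1, h.2]
    · rw [compress_singleton_of_not h]
      exact ⟨fun hYX => absurd (hYX ▸ hY) hX, fun h' => absurd ⟨h'.1, h'.2.1⟩ h⟩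

theorem compression_singleton_subset_powersetCard (hx : x ∈ S) (hF : F ⊆ powersetCard l S) :
    compression {x} {y} F ⊆ powersetCard l S := by
  intro X hX
  rcases mem_compression_singleton.1 hX with ⟨hXF, -⟩ | ⟨-, Y, hY, hxY, hyY, rfl⟩
  · exact hF hXF
  · obtain ⟨hYS, hYcard⟩ := mem_powersetCard.1 (hF hY)
    refine mem_powersetCard.2 ⟨insert_subset hx ((erase_subset y Y).trans hYS), ?_⟩
    rw [card_insert_of_notMem (notMem_mono (erase_subset y Y) hxY), card_erase_add_one hyY, hYcard]

theorem CrossIntersecting.insert_erase_inter_nonempty (h : CrossIntersecting A B) {X Y : Finset α}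
    (hX : X ∈ A) (hxX : x ∉ X) (hY : Y ∈ B)
    (hYB : x ∉ Y → y ∈ Y → insert x (Y.erase y) ∈ B) :
    (insert x (X.erase y) ∩ Y).Nonempty := by
  by_cases hxY : x ∈ Y
  · exact ⟨x, by simp [hxY]⟩
  rw [insert_inter_of_notMem hxY]
  by_cases hyY : y ∈ Y
  · have := h X hX _ (hYB hxY hyY)
    rwa [inter_insert_of_notMem hxX, inter_erase, ← erase_inter] at this
  · exact erase_inter_nonempty_of_notMem hyY (h X hX Y hY)

theorem CrossIntersecting.compression_singleton (h : CrossIntersecting A B) (x y : α) :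
    CrossIntersecting (compression {x} {y} A) (compression {x} {y} B) := by
  intro X hX Y hY
  rcases mem_compression_singleton.1 hX with ⟨hXA, hXA'⟩ | ⟨-, X₀, hX₀, hxX, -, rfl⟩ <;>
  rcases mem_compression_singleton.1 hY with ⟨hYB, hYB'⟩ | ⟨-, Y₀, hY₀, hxY, -, rfl⟩
  · exact h X hXA Y hYB
  · rw [inter_comm]
    exact h.symm.insert_erase_inter_nonempty hY₀ hxY hXA hXA'
  · exact h.insert_erase_inter_nonempty hX₀ hxX hYB hYB'
  · exact ⟨x, by simp⟩

theorem card_nonMemberSubfamily_le_card_compression (hc : c ≠ x) :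
    #(F.nonMemberSubfamily c) ≤ #((compression {x} {y} F).nonMemberSubfamily c) := by
  rw [← card_compression {x} {y} (F.nonMemberSubfamily c)]
  refine card_le_card fun X hX => ?_
  rw [mem_nonMemberSubfamily, mem_compression_singleton]
  rcases mem_compression_singleton.1 hX with ⟨hX, hX'⟩ | ⟨hX, Y, hY, hxY, hyY, rfl⟩ <;>
  simp only [mem_nonMemberSubfamily] at *
  · obtain ⟨hXF, hcX⟩ := hX
    exact ⟨Or.inl ⟨hXF, fun hx hy => (hX' hx hy).1⟩, hcX⟩
  · obtain ⟨hYF, hcY⟩ := hY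
    have hcX : c ∉ insert x (Y.erase y) := by simp [hc, hcY]
    exact ⟨Or.inr ⟨fun hXF => hX ⟨hXF, hcX⟩, Y, hYF, hxY, hyY, rfl⟩, hcX⟩

theorem nonMemberSubfamily_nonMemberSubfamily_subset_compression :
    (F.nonMemberSubfamily x).nonMemberSubfamily y ⊆
      (compression {x} {y} F).nonMemberSubfamily x := by
  intro X hX
  simp only [mem_nonMemberSubfamily] at hX
  rw [mem_nonMemberSubfamily, mem_compression_singleton]
  exact ⟨Or.inl ⟨hX.1.1, fun _ h => absurd h hX.2⟩, hX.1.2⟩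

end DecidableEq

section LinearOrder

variable {α : Type*} [LinearOrder α] {S : Finset α} {A B F : Finset (Finset α)} {x y : α} {l : ℕ}

/-- The total rank, with respect to `S`, of the elements of the members of `F`. It measures how far
`F` is from being shifted: every compression towards a smaller element of `S` lowers it. -/
def shiftWeight (S : Finset α) (F : Finset (Finset α)) : ℕ :=
  ∑ X ∈ F, ∑ z ∈ X, #{s ∈ S | s < z}

theorem shiftWeight_compression_lt (hx : x ∈ S) (hxy : x < y)
    (h : compression {x} {y} F ≠ F) : shiftWeight S (compression {x} {y} F) < shiftWeight S F := by
  have hrank : #{s ∈ S | s < x} < #{s ∈ S | s < y} :=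
    card_lt_card (ssubset_iff_of_subset (fun s hs => by
      simp only [mem_filter] at hs ⊢
      exact ⟨hs.1, hs.2.trans hxy⟩) |>.2 ⟨x, by simp [hx, hxy]⟩)
  have hlt : ∀ X ∈ F.filter (compress {x} {y} · ∉ F),
      ∑ z ∈ compress {x} {y} X, #{s ∈ S | s < z} < ∑ z ∈ X, #{s ∈ S | s < z} := by
    intro X hX
    obtain ⟨hXF, hX'⟩ := mem_filter.1 hX
    obtain ⟨hxX, hyX⟩ : x ∉ X ∧ y ∈ X := by
      by_contra hcon
      rw [compress_singleton_of_not hcon] at hX'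
      exact hX' hXF
    rw [compress_singleton_of_notMem_of_mem hxX hyX,
      sum_insert (notMem_mono (erase_subset y X) hxX), ← add_sum_erase X _ hyX]
    exact Nat.add_lt_add_right hrank _
  have hmoved : (F.filter (compress {x} {y} · ∉ F)).Nonempty := by
    by_contra! hempty
    refine h ?_
    rw [compression, filter_image, hempty, image_empty, union_empty]
    exact filter_true_of_mem fun X hX => not_not.1 (filter_eq_empty_iff.1 hempty hX)
  rw [shiftWeight, shiftWeight, compression, sum_union compress_disjoint, filter_image,
    sum_image compress_injOn, ← sum_filter_add_sum_filter_not F (compress {x} {y} · ∈ F)]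
  exact Nat.add_lt_add_left (sum_lt_sum_of_nonempty hmoved hlt) _

theorem shiftWeight_compression_le (hx : x ∈ S) (hxy : x < y) :
    shiftWeight S (compression {x} {y} F) ≤ shiftWeight S F := by
  by_cases h : compression {x} {y} F = F
  · rw [h]
  · exact (shiftWeight_compression_lt hx hxy h).le

theorem isShifted_of_compression_eq (hF : F ⊆ powersetCard l S)
    (h : ∀ x ∈ S, ∀ y ∈ S, x < y → compression {x} {y} F = F) : IsShifted S l F where
  subset_powersetCard := hF
  insert_erase_mem X hX y hy x hx hxy hxX := by
    rw [← h x hx y ((mem_powersetCard.1 (hF hX)).1 hy) hxy, mem_compression_singleton] at hX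
    rcases hX with ⟨-, hX⟩ | ⟨-, Y, -, -, -, rfl⟩
    · exact hX hxX hy
    · exact absurd (mem_insert_self x _) hxX

theorem CrossIntersecting.exists_isShifted (h : CrossIntersecting A B)
    (hA : A ⊆ powersetCard l S) (hB : B ⊆ powersetCard l S) :
    ∃ A' B', CrossIntersecting A' B' ∧ IsShifted S l A' ∧ IsShifted S l B' ∧
      #A' = #A ∧ #B' = #B := by
  induction hw : shiftWeight S A + shiftWeight S B using Nat.strong_induction_on
    generalizing A B with
  | _ w ih =>
  by_cases hs : ∃ x ∈ S, ∃ y ∈ S, x < y ∧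
      (compression {x} {y} A ≠ A ∨ compression {x} {y} B ≠ B)
  · obtain ⟨x, hx, y, -, hxy, hne⟩ := hs
    have hlt : shiftWeight S (compression {x} {y} A) + shiftWeight S (compression {x} {y} B) <
        w := by
      rw [← hw]
      rcases hne with hne | hne
      · exact Nat.add_lt_add_of_lt_of_le (shiftWeight_compression_lt hx hxy hne)
          (shiftWeight_compression_le hx hxy)
      · exact Nat.add_lt_add_of_le_of_lt (shiftWeight_compression_le hx hxy)
          (shiftWeight_compression_lt hx hxy hne)
    simpa only [card_compression] using ih _ hlt (h.compression_singleton x y)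
      (compression_singleton_subset_powersetCard hx hA)
      (compression_singleton_subset_powersetCard hx hB) rfl
  · push Not at hs
    exact ⟨A, B, h, isShifted_of_compression_eq hA fun x hx y hy hxy => (hs x hx y hy hxy).1,
      isShifted_of_compression_eq hB fun x hx y hy hxy => (hs x hx y hy hxy).2, rfl, rfl⟩

end LinearOrder

end Compression

section CrossBounds

variable {α : Type*} [DecidableEq α] {S : Finset α} {A B : Finset (Finset α)} {i l m q ε : ℕ}

theorem exists_linearOrder (α : Type*) [inst : DecidableEq α] :
    ∃ o : LinearOrder α, o.toDecidableEq = inst := by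
  classical exact ⟨linearOrderOfSTO WellOrderingRel, Subsingleton.elim _ _⟩

namespace CrossIntersecting

theorem card_add_card_add_choose_le (h : CrossIntersecting A B) (hA : A ⊆ powersetCard l S)
    (hB : B ⊆ powersetCard l S) (hS : #S = l + m) (hlm : l ≤ m) (hAn : A.Nonempty)
    (hBn : B.Nonempty) : #A + #B + m.choose l ≤ (#S).choose l + 1 := by
  obtain ⟨_, rfl⟩ := exists_linearOrder α
  obtain ⟨A', B', h', hA', hB', hcardA, hcardB⟩ := h.exists_isShifted hA hB
  rw [← card_pos] at hAn hBn
  rw [← hcardA] at hAn ⊢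
  rw [← hcardB] at hBn ⊢
  exact h'.card_add_card_add_choose_le_of_isShifted hA' hB' hS hlm (card_pos.1 hAn)
    (card_pos.1 hBn)

theorem card_add_card_add_missCount_le (h : CrossIntersecting A B)
    (hA : A ⊆ powersetCard (i + 2) S) (hB : B ⊆ powersetCard (i + 2) S) (hS : #S = i + q + 3)
    (hiq : i + 1 + ε ≤ q) (hε : ε ≤ 1) (hεi : ε < i) (hA₂ : 2 + ε ≤ #A)
    (hB₂ : 2 + ε ≤ #B) :
    #A + #B + missCount q (i + 1) + ε ≤ (#S).choose (i + 2) + 2 := by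
  obtain ⟨_, rfl⟩ := exists_linearOrder α
  obtain ⟨A', B', h', hA', hB', hcardA, hcardB⟩ := h.exists_isShifted hA hB
  rw [← hcardA] at hA₂ ⊢
  rw [← hcardB] at hB₂ ⊢
  exact h'.card_add_card_add_missCount_le_of_isShifted hA' hB' hS hiq hε hεi hA₂ hB₂

end CrossIntersecting

end CrossBounds

section IntersectingBound

open UV

variable {α : Type*} [DecidableEq α] {S : Finset α} {A B D F G : Finset (Finset α)} {x y : α}
  {i q ε : ℕ}

-- A member of `G` constrains `D`, and the loss in `#D` outweighs the weaker bound on `#A + #B`.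
theorem CrossIntersecting.card_add_card_add_card_add_card_add_missCount_le
    (hAB : CrossIntersecting A B) (hDG : CrossIntersecting D G)
    (hA : A ⊆ powersetCard (i + 2) S) (hB : B ⊆ powersetCard (i + 2) S)
    (hD : D ⊆ powersetCard (i + 1) S) (hG : G ⊆ powersetCard (i + 3) S) (hS : #S = i + q + 3)
    (hiq : i + 1 < q) (hε : ε ≤ 1) (hεi : ε < i) (hA₃ : 3 ≤ #A + #G) (hB₃ : 3 ≤ #B + #G)
    (hG₂ : #G ≤ 2) :
    #A + #B + #D + #G + missCount q (i + 1) + ε ≤ (i + q + 4).choose (i + 2) + 2 := by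
  obtain ⟨r, rfl⟩ := Nat.exists_eq_add_of_le' (Nat.one_le_of_lt hiq)
  rw [show i + (r + 1) + 4 = #S + 1 by lia, Nat.choose_succ_succ']
  obtain hcardG | hcardG | hcardG : #G = 0 ∨ #G = 1 ∨ #G = 2 := by lia
  · have hAB' := hAB.card_add_card_add_missCount_le hA hB hS (by lia) hε hεi (by lia) (by lia)
    have hD' := card_le_card hD
    rw [card_powersetCard] at hD'
    lia
  · have hAB' := hAB.card_add_card_add_missCount_le (ε := 0) hA hB hS (by lia) (by lia) (by lia)
      (by lia) (by lia)
    have hD' : #D + (r + 1).choose (i + 1) ≤ _ :=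
      hDG.card_add_choose_le hD hG (by lia) (card_pos.1 (by lia))
    have := two_le_choose (Nat.succ_pos i) hiq
    lia
  · have hAB' := hAB.card_add_card_add_choose_le (m := r + 2) hA hB (by lia) (by lia)
      (card_pos.1 (by lia)) (card_pos.1 (by lia))
    have hD' : #D + missCount r i ≤ _ := hDG.card_add_missCount_le hD hG (by lia) hcardG.ge
    have : 2 ≤ r.choose i := two_le_choose (by lia) (by lia)
    simp only [missCount, Nat.add_assoc, Nat.reduceAdd] at hAB' hD' ⊢
    lia

theorem CrossIntersecting.card_add_missCount_le_of_card_nonMemberSubfamily_le_two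
    (h : CrossIntersecting F F) (hF : F ⊆ powersetCard (i + 3) S) (hS : #S = i + q + 5)
    (hiq : i + 1 < q) (hε : ε ≤ 1) (hεi : ε < i) (hx : x ∈ S) (hy : y ∈ S) (hxy : x ≠ y)
    (hx₃ : 3 ≤ #(F.nonMemberSubfamily x)) (hy₃ : 3 ≤ #(F.nonMemberSubfamily y))
    (hxy₂ : #((F.nonMemberSubfamily x).nonMemberSubfamily y) ≤ 2) :
    #F + missCount q (i + 1) + ε ≤ (i + q + 4).choose (i + 2) + 2 := by
  have hcard : #((S.erase x).erase y) = i + q + 3 := by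
    rw [card_erase_of_mem (mem_erase.2 ⟨hxy.symm, hy⟩), card_erase_of_mem hx]
    lia
  have hFx := memberSubfamily_subset_powersetCard_erase (a := x) hF
  have hFx' := nonMemberSubfamily_subset_powersetCard_erase (a := x) hF
  have hbound := CrossIntersecting.card_add_card_add_card_add_card_add_missCount_le
    (h.memberSubfamily_nonMemberSubfamily.symm.memberSubfamily_nonMemberSubfamily.symm)
    h.memberSubfamily_nonMemberSubfamily.memberSubfamily_nonMemberSubfamily
    (nonMemberSubfamily_subset_powersetCard_erase hFx)
    (memberSubfamily_subset_powersetCard_erase hFx')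
    (memberSubfamily_subset_powersetCard_erase hFx)
    (nonMemberSubfamily_subset_powersetCard_erase hFx') hcard hiq hε hεi
    (by rwa [nonMemberSubfamily_memberSubfamily_comm hxy, nonMemberSubfamily_comm,
      card_memberSubfamily_add_card_nonMemberSubfamily])
    (by rwa [card_memberSubfamily_add_card_nonMemberSubfamily]) hxy₂
  rw [← card_memberSubfamily_add_card_nonMemberSubfamily x F,
    ← card_memberSubfamily_add_card_nonMemberSubfamily y (F.memberSubfamily x),
    ← card_memberSubfamily_add_card_nonMemberSubfamily y (F.nonMemberSubfamily x)]
  lia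

theorem CrossIntersecting.card_add_missCount_le_of_three_le (h : CrossIntersecting F F)
    (hF : F ⊆ powersetCard (i + 3) S) (hS : #S = i + q + 5) (hiq : i + 1 < q) (hε : ε ≤ 1)
    (hεi : ε < i) (h₃ : ∀ c ∈ S, 3 ≤ #(F.nonMemberSubfamily c)) :
    #F + missCount q (i + 1) + ε ≤ (i + q + 4).choose (i + 2) + 2 := by
  obtain ⟨_, rfl⟩ := exists_linearOrder α
  induction hw : shiftWeight S F using Nat.strong_induction_on generalizing F with
  | _ w ih =>
  by_cases hs : ∃ x ∈ S, ∃ y ∈ S, x < y ∧ compression {x} {y} F ≠ F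
  · obtain ⟨x, hx, y, hy, hxy, hne⟩ := hs
    by_cases hx₃ : 3 ≤ #((compression {x} {y} F).nonMemberSubfamily x)
    · have h₃' : ∀ c ∈ S, 3 ≤ #((compression {x} {y} F).nonMemberSubfamily c) := by
        intro c hc
        rcases eq_or_ne c x with rfl | hcx
        · exact hx₃
        · exact (h₃ c hc).trans (card_nonMemberSubfamily_le_card_compression hcx)
      rw [← card_compression {x} {y} F]
      exact ih _ (hw ▸ shiftWeight_compression_lt hx hxy hne)
        (compression_singleton_subset_powersetCard hx hF) (h.compression_singleton x y) h₃' rfl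
    · have := card_le_card
        (nonMemberSubfamily_nonMemberSubfamily_subset_compression (F := F) (x := x) (y := y))
      exact h.card_add_missCount_le_of_card_nonMemberSubfamily_le_two hF hS hiq hε hεi hx hy
        hxy.ne (h₃ x hx) (h₃ y hy) (by lia)
  · push Not at hs
    have hleast := S.isLeast_min' (card_pos.1 (by lia))
    exact (isShifted_of_compression_eq hF hs).card_add_missCount_le h hleast hS (by lia) hε hεi
      (h₃ _ hleast.1)

end IntersectingBound

/-! ### Extremal families -/

section Extremal

section Counting

variable {α : Type*} [DecidableEq α] {S T₁ T₂ : Finset α} {H : Finset (Finset α)} {t : α}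
  {i l q : ℕ}

theorem card_add_missCount_lt_of_two_le_card_sdiff (hH : H ⊆ powersetCard (i + 1) S)
    (hT₁ : T₁ ∈ powersetCard l S) (hT₂ : T₂ ∈ powersetCard l S) (hS : #S = l + q + 1)
    (hiq : i < q) (hd : 2 ≤ #(T₁ \ T₂)) (h₁ : ∀ X ∈ H, (X ∩ T₁).Nonempty)
    (h₂ : ∀ X ∈ H, (X ∩ T₂).Nonempty) : #H + missCount q i < (#S).choose (i + 1) := by
  obtain ⟨hT₁S, hT₁card⟩ := mem_powersetCard.1 hT₁
  obtain ⟨hT₂S, hT₂card⟩ := mem_powersetCard.1 hT₂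
  obtain ⟨x, hx, y, hy, hxy⟩ := one_lt_card.1 hd
  have hyS : {y} ⊆ (S \ T₂).erase x := singleton_subset_iff.2
    (mem_erase.2 ⟨hxy.symm, sdiff_subset_sdiff hT₁S le_rfl hy⟩)
  have hroom : i + 1 ≤ #((S \ T₂).erase x) := by
    rw [card_erase_of_mem (sdiff_subset_sdiff hT₁S le_rfl hx), card_sdiff_of_subset hT₂S]
    lia
  -- `Z` avoids `T₂` and `x`, so adding it to `H` respects the weaker condition
  -- that only the members through `x` have to meet `T₂`.
  obtain ⟨Z, hyZ, hZ, hZcard⟩ := exists_subsuperset_card_eq hyS (by simp) hroom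
  obtain ⟨hZS, hxZ⟩ := subset_erase.1 hZ
  have hZH : Z ∉ H := fun h =>
    (h₂ Z h).ne_empty (disjoint_iff_inter_eq_empty.1 (subset_sdiff.1 hZS).2)
  have hZ₁ : (Z ∩ T₁).Nonempty :=
    ⟨y, mem_inter.2 ⟨singleton_subset_iff.1 hyZ, (mem_sdiff.1 hy).1⟩⟩
  have hins := card_add_missCount_le_of_mem_sdiff (q := q)
    (insert_subset (mem_powersetCard.2 ⟨(subset_sdiff.1 hZS).1, hZcard⟩) hH) hT₁S hT₂S
    (by lia) (by lia) hx (forall_mem_insert .. |>.2 ⟨hZ₁, h₁⟩)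
    (forall_mem_insert .. |>.2 ⟨fun h => absurd h hxZ, fun X hX _ => h₂ X hX⟩)
  rw [card_insert_of_notMem hZH] at hins
  lia

theorem card_filter_meets_and_meets_add_missCount (hT₁ : T₁ ⊆ S) (hT₂ : T₂ ⊆ S)
    (hS₁ : #S = #T₁ + q + 1) (hS₂ : #S = #T₂ + q + 1) (hd : T₁ \ T₂ = {t}) :
    #{X ∈ powersetCard (i + 1) S | (X ∩ T₁).Nonempty ∧ (X ∩ T₂).Nonempty} + missCount q i =
      (#S).choose (i + 1) := by
  obtain ⟨ht₁, ht₂⟩ := mem_sdiff.1 (hd ▸ mem_singleton_self t)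
  have hcardS := card_erase_add_one (hT₁ ht₁)
  have hcardT := card_erase_add_one ht₁
  have hsub : T₁.erase t ⊆ T₂ := by
    rw [← sdiff_singleton_eq_erase, ← hd, sdiff_sdiff_right_self]
    exact inter_subset_right
  set H := {X ∈ powersetCard (i + 1) S | (X ∩ T₁).Nonempty ∧ (X ∩ T₂).Nonempty} with hH
  have hmem : H.memberSubfamily t =
      {X ∈ powersetCard i (S.erase t) | (X ∩ T₂).Nonempty} := by
    ext X
    by_cases htX : t ∈ X
    · simp [htX, subset_erase]
    · simp [hH, htX, insert_inter_of_mem ht₁, insert_inter_of_notMem ht₂, insert_subset_iff,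
        hT₁ ht₁, subset_erase, card_insert_of_notMem htX]
  have hnot : H.nonMemberSubfamily t =
      {X ∈ powersetCard (i + 1) (S.erase t) | (X ∩ T₁.erase t).Nonempty} := by
    ext X
    by_cases htX : t ∈ X
    · simp [htX, subset_erase]
    · have hX : X ∩ T₁.erase t = X ∩ T₁ := by
        rw [inter_erase, erase_eq_of_notMem fun h => htX (mem_inter.1 h).1]
      have himp : (X ∩ T₁).Nonempty → (X ∩ T₂).Nonempty := fun h =>
        (hX ▸ h).mono (inter_subset_inter_left hsub)
      simp only [hH, mem_nonMemberSubfamily, mem_filter, mem_powersetCard, subset_erase, hX]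
      tauto
  rw [← card_memberSubfamily_add_card_nonMemberSubfamily t H, hmem, hnot, ← hcardS,
    Nat.choose_succ_succ', missCount,
    ← card_filter_meets_add_choose (m := q) (subset_erase.2 ⟨hT₂, ht₂⟩) (by lia),
    ← card_filter_meets_add_choose (m := q + 1) (erase_subset_erase t hT₁) (by lia)]
  ring

end Counting

theorem exists_perm_map_eq {α : Type*} {L L' : List α} (hL : L.Nodup) (hL' : L'.Nodup)
    (hlen : L.length = L'.length) : ∃ σ : Equiv.Perm α, L.map σ = L' := by
  let e : Fin L.length ↪ α := ⟨L.get, List.nodup_iff_injective_get.1 hL⟩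
  let e' : Fin L.length ↪ α :=
    (finCongr hlen).toEmbedding.trans ⟨L'.get, List.nodup_iff_injective_get.1 hL'⟩
  have := Equiv.Perm.isMultiplyPretransitive α L.length
  obtain ⟨σ, hσ⟩ := MulAction.exists_smul_eq (Equiv.Perm α) e e'
  refine ⟨σ, List.ext_getElem (by simpa using hlen) fun j hj hj' => ?_⟩
  simpa [e, e'] using DFunLike.congr_fun hσ ⟨j, by simpa using hj⟩

section ExchangePair

variable {α : Type*} [DecidableEq α] {G₁ G₂ : Finset α} {c : α} {k : ℕ}

/-- Two `k`-sets that avoid `c` and arise from each other by exchanging a single element: the data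
of the largest families `pairStar k c G₁ G₂`. -/
structure IsExchangePair (k : ℕ) (c : α) (G₁ G₂ : Finset α) : Prop where
  card_left : #G₁ = k
  card_right : #G₂ = k
  notMem_left : c ∉ G₁
  notMem_right : c ∉ G₂
  card_sdiff : #(G₁ \ G₂) = 1

theorem IsExchangePair.exists_insert_eq (hG : IsExchangePair k c G₁ G₂) :
    ∃ C t₁ t₂, insert t₁ C = G₁ ∧ insert t₂ C = G₂ ∧ (c :: t₁ :: t₂ :: C.toList).Nodup := by
  obtain ⟨h₁, h₂, hc₁, hc₂, hd⟩ := hG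
  obtain ⟨t₁, ht₁⟩ := card_eq_one.1 hd
  obtain ⟨t₂, ht₂⟩ := card_eq_one.1 ((card_sdiff_comm (h₁.trans h₂.symm)).symm.trans hd)
  have hins₁ : insert t₁ (G₁ ∩ G₂) = G₁ := by
    rw [insert_eq, ← ht₁, sdiff_union_inter]
  have hins₂ : insert t₂ (G₁ ∩ G₂) = G₂ := by
    rw [insert_eq, ← ht₂, inter_comm, sdiff_union_inter]
  have ht₁' := mem_sdiff.1 (ht₁ ▸ mem_singleton_self t₁)
  have ht₂' := mem_sdiff.1 (ht₂ ▸ mem_singleton_self t₂)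
  refine ⟨G₁ ∩ G₂, t₁, t₂, hins₁, hins₂, ?_⟩
  have hne₁ : c ≠ t₁ := fun h => hc₁ (h ▸ ht₁'.1)
  have hne₂ : c ≠ t₂ := fun h => hc₂ (h ▸ ht₂'.1)
  have hne : t₁ ≠ t₂ := fun h => ht₁'.2 (h ▸ ht₂'.1)
  simp [hne₁, hne₂, hne, hc₁, ht₁', ht₂', nodup_toList]

end ExchangePair

section PairStar

variable {α : Type*} [Fintype α] [DecidableEq α] {F : Finset (Finset α)} {G₁ G₂ : Finset α}
  {c : α} {i k q : ℕ}

/-- The sets `G₁` and `G₂` together with all `k`-sets that contain `c` and meet both of them. The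
family `J₂` has this form, with `c` the first element of the ground set. -/
def pairStar (k : ℕ) (c : α) (G₁ G₂ : Finset α) : Finset (Finset α) :=
  {G₁, G₂} ∪ {X ∈ powersetCard k (univ : Finset α) | c ∈ X ∧ (X ∩ G₁).Nonempty ∧ (X ∩ G₂).Nonempty}

theorem nonMemberSubfamily_pairStar (h₁ : c ∉ G₁) (h₂ : c ∉ G₂) :
    (pairStar k c G₁ G₂).nonMemberSubfamily c = {G₁, G₂} := by
  ext X
  simp only [pairStar, mem_nonMemberSubfamily, mem_union, mem_filter, mem_insert, mem_singleton]
  constructor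
  · tauto
  · rintro (rfl | rfl) <;> tauto

theorem memberSubfamily_pairStar (h₁ : c ∉ G₁) (h₂ : c ∉ G₂) :
    (pairStar (k + 1) c G₁ G₂).memberSubfamily c =
      {X ∈ powersetCard k (univ.erase c) | (X ∩ G₁).Nonempty ∧ (X ∩ G₂).Nonempty} := by
  ext X
  by_cases hcX : c ∈ X
  · simp [hcX, subset_erase]
  have hne {G : Finset α} (hG : c ∉ G) : insert c X ≠ G := fun h => hG (h ▸ mem_insert_self c X)
  simp [pairStar, hcX, hne h₁, hne h₂, insert_inter_of_notMem h₁, insert_inter_of_notMem h₂,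
    subset_erase, card_insert_of_notMem hcX]

theorem CrossIntersecting.subset_pairStar (h : CrossIntersecting F F)
    (hF : F ⊆ powersetCard k univ) (hG : F.nonMemberSubfamily c = {G₁, G₂}) :
    F ⊆ pairStar k c G₁ G₂ := by
  have hmem {G : Finset α} (hG' : G ∈ ({G₁, G₂} : Finset (Finset α))) : G ∈ F :=
    nonMemberSubfamily_subset (hG ▸ hG')
  intro X hX
  by_cases hcX : c ∈ X
  · exact mem_union_right _ (mem_filter.2 ⟨hF hX, hcX, h X hX _ (hmem (by simp)),
      h X hX _ (hmem (by simp))⟩)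
  · exact mem_union_left _ (hG ▸ mem_nonMemberSubfamily.2 ⟨hX, hcX⟩)

theorem IsExchangePair.card_pairStar_add_missCount (hG : IsExchangePair (i + 2) c G₁ G₂)
    (hα : Fintype.card α = i + q + 4) :
    #(pairStar (i + 2) c G₁ G₂) + missCount q i = (i + q + 3).choose (i + 1) + 2 := by
  obtain ⟨h₁, h₂, hc₁, hc₂, hd⟩ := hG
  obtain ⟨t, ht⟩ := card_eq_one.1 hd
  have hne : G₁ ≠ G₂ := by
    rintro rfl
    simp at hd
  have hcard : #(univ.erase c) = i + q + 3 := by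
    rw [card_erase_of_mem (mem_univ c), card_univ, hα, Nat.add_succ_sub_one]
  rw [← card_memberSubfamily_add_card_nonMemberSubfamily c, memberSubfamily_pairStar hc₁ hc₂,
    nonMemberSubfamily_pairStar hc₁ hc₂, card_pair hne, add_right_comm,
    card_filter_meets_and_meets_add_missCount (subset_erase.2 ⟨subset_univ _, hc₁⟩)
      (subset_erase.2 ⟨subset_univ _, hc₂⟩) (by lia) (by lia) ht, hcard]

theorem image_pairStar (σ : Equiv.Perm α) :
    (pairStar k c G₁ G₂).image (fun X => X.image σ) =
      pairStar k (σ c) (G₁.image σ) (G₂.image σ) := by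
  rw [pairStar, pairStar, image_union, image_insert, image_singleton]
  congr 1
  ext Y
  obtain ⟨X, rfl⟩ : ∃ X, X.image σ = Y := ⟨Y.image σ.symm, by simp [image_image]⟩
  rw [(image_injective σ.injective).mem_finset_image]
  simp only [mem_filter, mem_powersetCard_univ, card_image_of_injective _ σ.injective,
    σ.injective.mem_finset_image, ← image_inter _ _ σ.injective, image_nonempty]

theorem IsExchangePair.exists_perm_image_pairStar {c' : α} {G₁' G₂' : Finset α}
    (hG : IsExchangePair k c G₁ G₂) (hG' : IsExchangePair k c' G₁' G₂') :
    ∃ σ : Equiv.Perm α, (pairStar k c G₁ G₂).image (fun X => X.image σ) =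
      pairStar k c' G₁' G₂' := by
  have hcard := hG.card_left.trans hG'.card_left.symm
  obtain ⟨C, t₁, t₂, rfl, rfl, hL⟩ := hG.exists_insert_eq
  obtain ⟨C', t₁', t₂', rfl, rfl, hL'⟩ := hG'.exists_insert_eq
  have ht₁ : t₁ ∉ C := fun h => by simp [h] at hL
  have ht₁' : t₁' ∉ C' := fun h => by simp [h] at hL'
  rw [card_insert_of_notMem ht₁, card_insert_of_notMem ht₁'] at hcard
  obtain ⟨σ, hσ⟩ := exists_perm_map_eq hL hL' (by simpa using hcard)
  simp only [List.map_cons, List.cons.injEq] at hσ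
  obtain ⟨hσc, hσ₁, hσ₂, hσC⟩ := hσ
  have hC : C.image σ = C' := by
    rw [← toList_toFinset C', ← hσC]
    ext x
    simp
  exact ⟨σ, by rw [image_pairStar, image_insert, image_insert, hσc, hσ₁, hσ₂, hC]⟩

theorem CrossIntersecting.card_add_missCount_le_of_card_nonMemberSubfamily_eq_two
    (h : CrossIntersecting F F) (hF : F ⊆ powersetCard (i + 2) univ)
    (hα : Fintype.card α = i + q + 4) (hc : #(F.nonMemberSubfamily c) = 2) :
    #F + missCount q i ≤ (i + q + 3).choose (i + 1) + 2 := by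
  have hcard : #(univ.erase c) = i + q + 3 := by
    rw [card_erase_of_mem (mem_univ c), card_univ, hα, Nat.add_succ_sub_one]
  have hmem : #(F.memberSubfamily c) + missCount q i ≤ _ :=
    h.memberSubfamily_nonMemberSubfamily.card_add_missCount_le
      (memberSubfamily_subset_powersetCard_erase hF)
      (nonMemberSubfamily_subset_powersetCard_erase hF) (by lia) hc.ge
  rw [hcard] at hmem
  rw [← card_memberSubfamily_add_card_nonMemberSubfamily c F]
  lia

theorem CrossIntersecting.exists_eq_pairStar_of_card_nonMemberSubfamily_eq_two
    (h : CrossIntersecting F F) (hF : F ⊆ powersetCard (i + 2) univ)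
    (hα : Fintype.card α = i + q + 4) (hiq : i < q) (hc : #(F.nonMemberSubfamily c) = 2)
    (hmax : (i + q + 3).choose (i + 1) + 2 ≤ #F + missCount q i) :
    ∃ G₁ G₂, IsExchangePair (i + 2) c G₁ G₂ ∧ F = pairStar (i + 2) c G₁ G₂ := by
  have hcard : #(univ.erase c) = i + q + 3 := by
    rw [card_erase_of_mem (mem_univ c), card_univ, hα, Nat.add_succ_sub_one]
  have hcross := h.memberSubfamily_nonMemberSubfamily (a := c)
  have hnon := nonMemberSubfamily_subset_powersetCard_erase (a := c) hF
  rw [← card_memberSubfamily_add_card_nonMemberSubfamily c F, hc] at hmax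
  obtain ⟨G₁, G₂, hne, hG⟩ := card_eq_two.1 hc
  rw [hG] at hcross hnon
  obtain ⟨hG₁, hG₂⟩ := insert_subset_iff.1 hnon
  rw [singleton_subset_iff] at hG₂
  have hd : #(G₁ \ G₂) = 1 := by
    have hG₁card := (mem_powersetCard.1 hG₁).2
    have hG₂card := (mem_powersetCard.1 hG₂).2
    obtain ⟨t, ht⟩ := exists_mem_sdiff_of_card_eq hne (hG₁card.trans hG₂card.symm)
    have hpos := card_pos.2 ⟨t, ht⟩
    by_contra hd
    have hlt := card_add_missCount_lt_of_two_le_card_sdiff (q := q)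
      (memberSubfamily_subset_powersetCard_erase hF) hG₁ hG₂ (by lia) hiq (by lia)
      (fun X hX => hcross X hX G₁ (by simp)) (fun X hX => hcross X hX G₂ (by simp))
    rw [hcard] at hlt
    lia
  have hpair : IsExchangePair (i + 2) c G₁ G₂ := by
    rw [mem_powersetCard, subset_erase] at hG₁ hG₂
    exact ⟨hG₁.2, hG₂.2, hG₁.1.2, hG₂.1.2, hd⟩
  refine ⟨G₁, G₂, hpair, eq_of_subset_of_card_le (h.subset_pairStar hF hG) ?_⟩
  have := hpair.card_pairStar_add_missCount hα
  have := card_memberSubfamily_add_card_nonMemberSubfamily c F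
  lia

theorem CrossIntersecting.card_add_missCount_le_of_two_le (h : CrossIntersecting F F)
    (hF : F ⊆ powersetCard (i + 3) univ) (hα : Fintype.card α = i + q + 5) (hi : 1 ≤ i)
    (hiq : i + 1 < q) (h₂ : ∀ c, 2 ≤ #(F.nonMemberSubfamily c)) :
    #F + missCount q (i + 1) ≤ (i + q + 4).choose (i + 2) + 2 := by
  by_cases h₃ : ∀ c, 3 ≤ #(F.nonMemberSubfamily c)
  · exact h.card_add_missCount_le_of_three_le (ε := 0) hF (card_univ.trans hα) hiq zero_le_one hi
      fun c _ => h₃ c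
  · push Not at h₃
    obtain ⟨c, hc⟩ := h₃
    rw [show i + q + 4 = i + 1 + q + 3 by lia]
    exact h.card_add_missCount_le_of_card_nonMemberSubfamily_eq_two (i := i + 1) (q := q) hF
      (by lia) (Nat.le_antisymm (Nat.le_of_lt_succ hc) (h₂ c))

theorem CrossIntersecting.exists_eq_pairStar (h : CrossIntersecting F F)
    (hF : F ⊆ powersetCard (i + 3) univ) (hα : Fintype.card α = i + q + 5) (hi : 2 ≤ i)
    (hiq : i + 1 < q) (h₂ : ∀ c, 2 ≤ #(F.nonMemberSubfamily c))
    (hmax : (i + q + 4).choose (i + 2) + 2 ≤ #F + missCount q (i + 1)) :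
    ∃ c G₁ G₂, IsExchangePair (i + 3) c G₁ G₂ ∧ F = pairStar (i + 3) c G₁ G₂ := by
  obtain ⟨c, hc⟩ : ∃ c, #(F.nonMemberSubfamily c) < 3 := by
    by_contra! h₃
    have := h.card_add_missCount_le_of_three_le (ε := 1) hF (card_univ.trans hα) hiq le_rfl hi
      fun c _ => h₃ c
    lia
  rw [show i + q + 4 = i + 1 + q + 3 by lia] at hmax
  exact ⟨c, h.exists_eq_pairStar_of_card_nonMemberSubfamily_eq_two (i := i + 1) hF (by lia) hiq
    (Nat.le_antisymm (Nat.le_of_lt_succ hc) (h₂ c)) hmax⟩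

end PairStar

section Intervals

variable {n k : ℕ} {F : Finset (Finset (Fin n))}

theorem two_le_card_nonMemberSubfamily (h : 2 ≤ diversity F) (c : Fin n) :
    2 ≤ #(F.nonMemberSubfamily c) := by
  have hdegree : familyDegree F c ≤ familyMaxDegree F := le_sup (mem_univ c)
  have hsplit : familyDegree F c + #(F.nonMemberSubfamily c) = #F :=
    card_filter_add_card_filter_not (s := F) (c ∈ ·)
  rw [diversity] at h
  lia

theorem intervalSet_eq_Icc {i : ℕ} (h : k + i < n) :
    intervalSet n (k + 1) i = Icc ⟨i, by lia⟩ ⟨k + i, h⟩ := by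
  ext x
  simp only [intervalSet, groundInterval, mem_filter, mem_univ, true_and, mem_Icc, Fin.le_def]
  lia

theorem familyJ_two [NeZero n] :
    familyJ n k 2 = pairStar k 0 (intervalSet n k 1) (intervalSet n k 2) := by
  have hzero (x : Fin n) : (x : ℕ) + 1 = 1 ↔ x = 0 := by
    rw [Fin.ext_iff, Fin.val_zero, Nat.add_eq_right]
  simp only [familyJ, pairStar, hzero, exists_eq_right]

theorem isExchangePair_intervalSet [NeZero n] (h : k + 2 < n) :
    IsExchangePair (k + 1) (0 : Fin n) (intervalSet n (k + 1) 1) (intervalSet n (k + 1) 2) := by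
  rw [intervalSet_eq_Icc (by lia), intervalSet_eq_Icc h]
  refine ⟨?_, ?_, ?_, ?_, ?_⟩
  · simp
  · simp
  · simp
  · simp
  · refine card_eq_one.2 ⟨⟨1, by lia⟩, ?_⟩
    ext x
    simp only [mem_sdiff, mem_Icc, Fin.le_def, mem_singleton, Fin.ext_iff]
    lia

end Intervals

end Extremal

theorem mainTheorem9 (n k : ℕ) (hk : 4 ≤ k) (hn : 2 * k < n)
    (F : Finset (Finset (Fin n)))
    (hF : ∀ A ∈ F, A.card = k)
    (hint : ∀ A ∈ F, ∀ B ∈ F, (A ∩ B).Nonempty)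
    (hdiv : 2 ≤ diversity F) :
    (F.card : ℤ) ≤ ((n - 1).choose (k - 1) : ℤ) - ((n - k - 1).choose (k - 1) : ℤ)
        - ((n - k - 2).choose (k - 2) : ℤ) + 2 ∧
      (5 ≤ k →
        ((F.card : ℤ) = ((n - 1).choose (k - 1) : ℤ) - ((n - k - 1).choose (k - 1) : ℤ)
            - ((n - k - 2).choose (k - 2) : ℤ) + 2 ↔
          FamilyIsomorphic F (familyJ n k 2))) := by
  obtain ⟨i, rfl⟩ := Nat.exists_eq_add_of_le' (Nat.le_of_succ_le hk)
  obtain ⟨q, rfl⟩ : ∃ q, n = i + q + 5 := ⟨n - (i + 5), by lia⟩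
  rw [show i + q + 5 - 1 = i + q + 4 by lia, show i + q + 5 - (i + 3) - 1 = q + 1 by lia,
    show i + q + 5 - (i + 3) - 2 = q by lia, show i + 3 - 1 = i + 1 + 1 by lia,
    show i + 3 - 2 = i + 1 by lia]
  have hFk : F ⊆ powersetCard (i + 3) univ := fun A hA => mem_powersetCard_univ.2 (hF A hA)
  have h₂ := two_le_card_nonMemberSubfamily hdiv
  have hα := Fintype.card_fin (i + q + 5)
  have hJ : IsExchangePair (i + 3) (0 : Fin (i + q + 5)) _ _ :=
    isExchangePair_intervalSet (by lia)
  have hle := CrossIntersecting.card_add_missCount_le_of_two_le hint hFk hα (by lia) (by lia) h₂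
  rw [missCount] at hle
  refine ⟨by lia, fun h5 => ⟨fun heq => ?_, ?_⟩⟩
  · obtain ⟨c, G₁, G₂, hG, rfl⟩ := CrossIntersecting.exists_eq_pairStar hint hFk hα (by lia)
      (by lia) h₂ (by rw [missCount]; lia)
    exact familyJ_two (n := i + q + 5) ▸ hG.exists_perm_image_pairStar hJ
  · rintro ⟨σ, hσ⟩
    have hcard := hJ.card_pairStar_add_missCount (i := i + 1) (q := q) (by lia)
    rw [← familyJ_two, ← hσ, card_image_of_injective _ (image_injective σ.injective),
      missCount] at hcard
    rw [show i + 1 + q + 3 = i + q + 4 by lia] at hcard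
    lia
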